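/- Let $H$ be a real Hilbert space (not necessarily separable). A set $E\subseteq H$ is called porous if there is $c\in(0,1)$ such that for every $x\in E$ and every $\varepsilon>0$ there exist $h\in H$ and $r>0$ with $\|x-h\|<\varepsilon$, $B(h,r)\cap E=\emptyset$ and $r>c\,\|x-h\|$, where $B(h,r)$ is the open ball with centre $h$ and radius $r$. A set is $\sigma$-porous if it is a countable union of porous sets. Equip the space $C^1([0,1],H)$ with the norm $\sup_{t}\|\gamma(t)\|+\sup_{t}\|\gamma'(t)\|$. Theorem. Every $\sigma$-porous set $P\subseteq H$ is $\Gamma_1$-null; that is, there is a residual subset $R$ of $C^1([0,1],H)$ (a set containing a countable intersection of dense open sets) such that for every $\gamma\in R$ the set $\{t\in[0,1]:\gamma(t)\in P\}$ has (outer) Lebesgue measure zero. -/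

import Mathlib

open Set Filter MeasureTheory

/-- `E` is `c`-porous at `x`: arbitrarily close to `x` there are centres `h` of open balls
`B(h, r)`, `r > c * d(x, h)`, that miss `E`. -/
def IsPorousAt {M : Type*} [MetricSpace M] (c : ℝ) (E : Set M) (x : M) : Prop :=
  ∀ ε : ℝ, 0 < ε → ∃ (h : M) (r : ℝ),
    0 < r ∧ dist x h < ε ∧ Metric.ball h r ∩ E = ∅ ∧ c * dist x h < r

/-- `E` is porous: for some `c ∈ (0,1)` it is `c`-porous at each of its points. -/
def IsPorous {M : Type*} [MetricSpace M] (E : Set M) : Prop :=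
  ∃ c ∈ Ioo (0 : ℝ) 1, ∀ x ∈ E, IsPorousAt c E x

/-- `P` is σ-porous: it is a countable union of porous sets (the empty set is porous, so
unions indexed by `ℕ` also cover finite unions). -/
def IsSigmaPorous {M : Type*} [MetricSpace M] (P : Set M) : Prop :=
  ∃ E : ℕ → Set M, (∀ n, IsPorous (E n)) ∧ P = ⋃ n, E n

/-- The space `C¹([0,1], X)`: pairs `(γ, γ')` of continuous maps `[0,1] → X` such that `γ'` is the
derivative of `γ` on `[0,1]` (one-sided at the end points). The pair is determined by `γ`. The norm
inherited from the `ℓ¹`-product is `‖γ‖ + ‖γ'‖`, with sup-norms on the right. -/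
def C1Curve (X : Type*) [NormedAddCommGroup X] [NormedSpace ℝ X] :
    Submodule ℝ (WithLp 1 (C(Icc (0 : ℝ) 1, X) × C(Icc (0 : ℝ) 1, X))) where
  carrier := {p | ∀ t : Icc (0 : ℝ) 1,
    HasDerivWithinAt (IccExtend (zero_le_one' ℝ) p.fst) (p.snd t) (Icc 0 1) t}
  add_mem' := fun ha hb t => (ha t).add (hb t)
  zero_mem' := fun t => hasDerivWithinAt_const (t : ℝ) (Icc 0 1) (0 : X)
  smul_mem' := fun c _ hp t => (hp t).const_smul c

namespace C1Curve

variable {X : Type*} [NormedAddCommGroup X] [NormedSpace ℝ X]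

/-- The underlying curve `γ : [0,1] → X`. -/
def curve (γ : C1Curve X) : C(Icc (0 : ℝ) 1, X) := γ.1.fst

/-- The derivative `γ' : [0,1] → X`. -/
def deriv (γ : C1Curve X) : C(Icc (0 : ℝ) 1, X) := γ.1.snd

theorem norm_eq (γ : C1Curve X) : ‖γ‖ = ‖curve γ‖ + ‖deriv γ‖ :=
  WithLp.prod_norm_eq_of_L1 γ.1

/-- An element of `C1Curve X` is determined by the underlying curve. -/
theorem curve_injective : Function.Injective (curve : C1Curve X → C(Icc (0 : ℝ) 1, X)) := by
  intro γ δ h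
  have h2 : γ.1.snd = δ.1.snd := by
    ext t
    have h1 := γ.2 t
    have h2 := δ.2 t
    have h' : γ.1.fst = δ.1.fst := h
    rw [h'] at h1
    exact (uniqueDiffOn_Icc_zero_one t t.2).eq_deriv _ h1 h2
  apply Subtype.ext
  apply WithLp.ofLp_injective
  exact Prod.ext h h2

/-- The underlying curves are exactly the maps that are `C¹` on `[0,1]`. -/
theorem exists_curve_eq_iff (f : C(Icc (0 : ℝ) 1, X)) :
    (∃ γ : C1Curve X, curve γ = f) ↔
      ContDiffOn ℝ 1 (IccExtend (zero_le_one' ℝ) f) (Icc 0 1) := by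
  rw [contDiffOn_one_iff_derivWithin uniqueDiffOn_Icc_zero_one]
  constructor
  · rintro ⟨γ, rfl⟩
    have hd : ∀ t : Icc (0 : ℝ) 1,
        HasDerivWithinAt (IccExtend (zero_le_one' ℝ) (curve γ)) (deriv γ t) (Icc 0 1) t := γ.2
    refine ⟨fun t ht => (hd ⟨t, ht⟩).differentiableWithinAt, ?_⟩
    rw [continuousOn_iff_continuous_domRestrict]
    convert (deriv γ).continuous using 1
    ext t
    exact (hd t).derivWithin (uniqueDiffOn_Icc_zero_one t t.2)
  · rintro ⟨hd, hc⟩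
    rw [continuousOn_iff_continuous_domRestrict] at hc
    exact ⟨⟨WithLp.toLp 1 (f, ⟨_, hc⟩), fun t => (hd t t.2).hasDerivWithinAt⟩, rfl⟩

end C1Curve

/-- `A` is `Γ₁`-null: for residually many `γ ∈ C¹([0,1], X)` the set `{t ∈ [0,1] | γ t ∈ A}` has
(outer) Lebesgue measure zero. -/
def IsGammaOneNull {X : Type*} [NormedAddCommGroup X] [NormedSpace ℝ X] (A : Set X) : Prop :=
  ∀ᶠ γ : C1Curve X in residual (C1Curve X),
    volume {t : ℝ | ∃ ht : t ∈ Icc (0 : ℝ) 1, C1Curve.curve γ ⟨t, ht⟩ ∈ A} = 0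

/-! Countable unions reduce the claim to one porous set `E` with constant `c`. Enlarge `E` to a set
`A`, the intersection of the closed set `F = closure E` with a `G_δ`, such that `F` has `c`-holes
arbitrarily near each point of `A`. The time spent in `A` is then a Borel function of the curve. If
the curves spending time at least `q > 0` in `A` were not meagre, the Baire property would make them
dense in some open set, hence in a `τ`-neighbourhood `S` of some `γ₀`.

This is impossible by a variational argument (`not_forall_frequently_volume_times`). Consider `Φ(γ)
= |{t : γ t ∈ F}| + K ∫ ‖γ' - γ₀'‖²` on `S`. It is upper semicontinuous because `F` is closed, so
density provides an almost minimizer `γ` that spends time at least `q` in `A`. Around many of these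
times, on disjoint short intervals of total length `ℓ` at least `q / 4`, add a bump of slope at most
`σ` that pushes the curve into a hole of `F`. The curve stays in the hole for a proportion of the
interval of order `c σ`, so the first term drops by at least a constant times `c σ ℓ`
(`volume_times_bend_le`). The derivative of a bump has mean zero and `γ' - γ₀'` is nearly constant
on each interval; hence in a Hilbert space the energy grows only by order `σ² ℓ`
(`energy_bend_sub_le`). For small `σ` the linear gain wins and contradicts almost minimality. The
energy term also makes `γ' - γ₀'` small at most times, leaving room to bend without leaving `S`. -/

open scoped Topology ENNReal

/-! ### Basic calculus of curves and their extensions to the line -/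

namespace C1Curve

variable {X : Type*} [NormedAddCommGroup X] [NormedSpace ℝ X]

/-- The curve `γ`, extended to the line by constants. -/
noncomputable def ext (γ : C1Curve X) : ℝ → X := IccExtend (zero_le_one' ℝ) (curve γ)

/-- The derivative of `γ`, extended to the line by constants. -/
noncomputable def dext (γ : C1Curve X) : ℝ → X := IccExtend (zero_le_one' ℝ) (deriv γ)

theorem ext_of_mem (γ : C1Curve X) {t : ℝ} (ht : t ∈ Icc (0 : ℝ) 1) :
    ext γ t = curve γ ⟨t, ht⟩ := IccExtend_of_mem _ _ ht

theorem dext_of_mem (γ : C1Curve X) {t : ℝ} (ht : t ∈ Icc (0 : ℝ) 1) :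
    dext γ t = deriv γ ⟨t, ht⟩ := IccExtend_of_mem _ _ ht

theorem continuous_ext (γ : C1Curve X) : Continuous (ext γ) := (curve γ).continuous.Icc_extend'

theorem continuous_dext (γ : C1Curve X) : Continuous (dext γ) := (deriv γ).continuous.Icc_extend'

theorem hasDerivWithinAt_ext (γ : C1Curve X) {t : ℝ} (ht : t ∈ Icc (0 : ℝ) 1) :
    HasDerivWithinAt (ext γ) (dext γ t) (Icc 0 1) t := by
  rw [dext_of_mem γ ht]
  exact γ.2 ⟨t, ht⟩

theorem norm_ext_le (γ : C1Curve X) (t : ℝ) : ‖ext γ t‖ ≤ ‖curve γ‖ :=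
  (curve γ).norm_coe_le_norm _

theorem norm_dext_le (γ : C1Curve X) (t : ℝ) : ‖dext γ t‖ ≤ ‖deriv γ‖ :=
  (deriv γ).norm_coe_le_norm _

@[simp] theorem ext_add (γ δ : C1Curve X) (t : ℝ) : ext (γ + δ) t = ext γ t + ext δ t := rfl
@[simp] theorem ext_sub (γ δ : C1Curve X) (t : ℝ) : ext (γ - δ) t = ext γ t - ext δ t := rfl
@[simp] theorem dext_add (γ δ : C1Curve X) (t : ℝ) : dext (γ + δ) t = dext γ t + dext δ t := rfl
@[simp] theorem dext_sub (γ δ : C1Curve X) (t : ℝ) : dext (γ - δ) t = dext γ t - dext δ t := rfl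
@[simp] theorem deriv_sub (γ δ : C1Curve X) : deriv (γ - δ) = deriv γ - deriv δ := rfl

theorem ext_sum {ι : Type*} (s : Finset ι) (f : ι → C1Curve X) (t : ℝ) :
    ext (∑ i ∈ s, f i) t = ∑ i ∈ s, ext (f i) t := by
  classical
  induction s using Finset.induction_on with
  | empty => rfl
  | insert a s ha ih => rw [Finset.sum_insert ha, Finset.sum_insert ha, ext_add, ih]

theorem dext_sum {ι : Type*} (s : Finset ι) (f : ι → C1Curve X) (t : ℝ) :
    dext (∑ i ∈ s, f i) t = ∑ i ∈ s, dext (f i) t := by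
  classical
  induction s using Finset.induction_on with
  | empty => rfl
  | insert a s ha ih => rw [Finset.sum_insert ha, Finset.sum_insert ha, dext_add, ih]

theorem continuous_curve : Continuous (curve : C1Curve X → C(Icc (0 : ℝ) 1, X)) :=
  (WithLp.prod_continuous_ofLp 1 _ _).fst.comp continuous_subtype_val

theorem continuous_deriv : Continuous (deriv : C1Curve X → C(Icc (0 : ℝ) 1, X)) :=
  (WithLp.prod_continuous_ofLp 1 _ _).snd.comp continuous_subtype_val

theorem norm_curve_le (γ : C1Curve X) : ‖curve γ‖ ≤ ‖γ‖ := by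
  rw [norm_eq]; linarith [norm_nonneg (deriv γ)]

theorem norm_ext_sub_le (γ : C1Curve X) {s t : ℝ} (hs : s ∈ Icc (0 : ℝ) 1)
    (ht : t ∈ Icc (0 : ℝ) 1) : ‖ext γ s - ext γ t‖ ≤ ‖deriv γ‖ * |s - t| :=
  (convex_Icc (0 : ℝ) 1).norm_image_sub_le_of_norm_hasDerivWithin_le
    (fun _ hx => hasDerivWithinAt_ext γ hx) (fun _ _ => norm_dext_le γ _) ht hs

/-- The restriction to `[0,1]` of a `C¹` map on the line. -/
def ofHasDerivAt (ψ ψ' : ℝ → X) (h : ∀ t, HasDerivAt ψ (ψ' t) t) (hc : Continuous ψ') :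
    C1Curve X :=
  ⟨WithLp.toLp 1 (⟨fun t => ψ t, (continuous_iff_continuousAt.2
      fun t => (h t).continuousAt).comp continuous_subtype_val⟩,
    ⟨fun t => ψ' t, hc.comp continuous_subtype_val⟩), fun t =>
      (h t).hasDerivWithinAt.congr (fun _ hx => IccExtend_of_mem _ _ hx)
        (IccExtend_of_mem _ _ t.2)⟩

theorem ext_ofHasDerivAt {ψ ψ' : ℝ → X} (h : ∀ t, HasDerivAt ψ (ψ' t) t) (hc : Continuous ψ')
    {t : ℝ} (ht : t ∈ Icc (0 : ℝ) 1) : ext (ofHasDerivAt ψ ψ' h hc) t = ψ t :=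
  ext_of_mem _ ht

theorem dext_ofHasDerivAt {ψ ψ' : ℝ → X} (h : ∀ t, HasDerivAt ψ (ψ' t) t) (hc : Continuous ψ')
    {t : ℝ} (ht : t ∈ Icc (0 : ℝ) 1) : dext (ofHasDerivAt ψ ψ' h hc) t = ψ' t :=
  dext_of_mem _ ht

/-! ### Completeness and the Baire property of the curve space -/

section Complete

variable [CompleteSpace X]

/-- The integral form of the derivative condition survives uniform limits, which is what closedness
and hence completeness need. -/
theorem mem_iff_integral (p : WithLp 1 (C(Icc (0 : ℝ) 1, X) × C(Icc (0 : ℝ) 1, X))) :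
    p ∈ C1Curve X ↔ ∀ t : Icc (0 : ℝ) 1,
      p.fst t = p.fst ⟨0, by simp⟩ + ∫ s in (0 : ℝ)..t, IccExtend (zero_le_one' ℝ) p.snd s := by
  have hc : Continuous (IccExtend (zero_le_one' ℝ) p.snd) := p.snd.continuous.Icc_extend'
  constructor
  · intro hp t
    have hγ := fun x hx => hasDerivWithinAt_ext (⟨p, hp⟩ : C1Curve X) (t := x) hx
    have := intervalIntegral.integral_eq_sub_of_hasDeriv_right_of_le (a := 0) (b := t) t.2.1
      (f := ext ⟨p, hp⟩) (f' := dext ⟨p, hp⟩) (continuous_ext _).continuousOn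
      (fun x hx => ((hγ x ⟨hx.1.le, hx.2.le.trans t.2.2⟩).hasDerivAt
        (Icc_mem_nhds hx.1 (hx.2.trans_le t.2.2))).hasDerivWithinAt)
      ((continuous_dext _).intervalIntegrable _ _)
    have h0 : ext ⟨p, hp⟩ 0 = p.fst ⟨0, by simp⟩ := ext_of_mem _ (by simp)
    have h1 : ext ⟨p, hp⟩ t = p.fst t := ext_of_mem _ t.2
    rw [h0, h1] at this
    change ∫ y in (0 : ℝ)..t, IccExtend (zero_le_one' ℝ) p.snd y = _ at this
    rw [this]; abel
  · intro hp t
    have h := ((hc.integral_hasStrictDerivAt 0 (t : ℝ)).hasDerivAt.const_add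
      (p.fst ⟨0, by simp⟩)).hasDerivWithinAt (s := Icc 0 1)
    rw [IccExtend_of_mem _ _ t.2] at h
    refine h.congr (fun x hx => ?_) ?_
    · rw [IccExtend_of_mem _ _ hx]; exact hp ⟨x, hx⟩
    · rw [IccExtend_of_mem _ _ t.2]; exact hp t

theorem isClosed_coe : IsClosed (C1Curve X : Set (WithLp 1 (C(Icc (0 : ℝ) 1, X) ×
    C(Icc (0 : ℝ) 1, X)))) := by
  have : (C1Curve X : Set (WithLp 1 (C(Icc (0 : ℝ) 1, X) × C(Icc (0 : ℝ) 1, X)))) =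
      ⋂ t : Icc (0 : ℝ) 1, {p | p.fst t = p.fst ⟨0, by simp⟩ +
        ∫ s in (0 : ℝ)..t, IccExtend (zero_le_one' ℝ) p.snd s} := by
    ext p; simp only [SetLike.mem_coe, mem_iff_integral, mem_iInter, mem_ofPred_eq]
  rw [this]
  have hf : Continuous fun p : WithLp 1 (C(Icc (0 : ℝ) 1, X) × C(Icc (0 : ℝ) 1, X)) => p.fst :=
    (WithLp.prod_continuous_ofLp 1 _ _).fst
  have hs : Continuous fun p : WithLp 1 (C(Icc (0 : ℝ) 1, X) × C(Icc (0 : ℝ) 1, X)) => p.snd :=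
    (WithLp.prod_continuous_ofLp 1 _ _).snd
  refine isClosed_iInter fun t => isClosed_eq ?_ (Continuous.add ?_ ?_)
  · exact (continuous_eval_const t).comp hf
  · exact (continuous_eval_const _).comp hf
  · refine intervalIntegral.continuous_parametric_intervalIntegral_of_continuous' ?_ 0 (t : ℝ)
    exact ContinuousEval.continuous_eval.comp
      ((hs.comp continuous_fst).prodMk ((continuous_projIcc (h := zero_le_one' ℝ)).comp continuous_snd))

instance : CompleteSpace (C1Curve X) := isClosed_coe.completeSpace_coe

instance : BaireSpace (C1Curve X) :=
  have : TopologicalSpace.IsCompletelyPseudoMetrizableSpace (C1Curve X) :=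
    PseudoMetricSpace.toIsCompletelPseudoMetrizableSpace
  BaireSpace.of_completelyPseudoMetrizable

end Complete

end C1Curve

/-! ### A `C¹` bump and the curves built from it -/

/-- The square of the positive part is `C¹`. -/
theorem hasDerivAt_max_zero_sq (x : ℝ) :
    HasDerivAt (fun y : ℝ => max y 0 ^ 2) (2 * max x 0) x := by
  rcases lt_trichotomy x 0 with hx | rfl | hx
  · rw [max_eq_right hx.le, mul_zero]
    refine (hasDerivAt_const x (0 : ℝ)).congr_of_eventuallyEq ?_
    filter_upwards [gt_mem_nhds hx] with y hy
    rw [max_eq_right hy.le]; norm_num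
  · rw [max_self, mul_zero, hasDerivAt_iff_isLittleO_nhds_zero]
    refine Asymptotics.IsBigO.trans_isLittleO (g := fun h : ℝ => h ^ 2) ?_
      (by simpa using Asymptotics.isLittleO_pow_id (𝕜 := ℝ) one_lt_two)
    refine Asymptotics.isBigO_of_le _ fun h => ?_
    rcases le_total h 0 with h0 | h0 <;> simp [h0, sq_nonneg]
  · rw [max_eq_left hx.le]
    have := hasDerivAt_pow 2 x
    norm_num at this
    refine this.congr_of_eventuallyEq ?_
    filter_upwards [lt_mem_nhds hx] with y hy
    rw [max_eq_left hy.le]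

/-- A `C¹` bump function with support `[-1,1]` and value `1` at `0`. -/
noncomputable def quarticBump (s : ℝ) : ℝ := max (1 - s ^ 2) 0 ^ 2

/-- The derivative of `quarticBump`. -/
noncomputable def quarticBumpDeriv (s : ℝ) : ℝ := 2 * max (1 - s ^ 2) 0 * (-(2 * s))

theorem hasDerivAt_quarticBump (s : ℝ) : HasDerivAt quarticBump (quarticBumpDeriv s) s := by
  have h : HasDerivAt (fun s : ℝ => 1 - s ^ 2) (-(2 * s)) s := by
    simpa using (hasDerivAt_pow 2 s).const_sub 1
  exact (hasDerivAt_max_zero_sq (1 - s ^ 2)).comp s h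

theorem continuous_quarticBumpDeriv : Continuous quarticBumpDeriv := by
  unfold quarticBumpDeriv; fun_prop

@[simp] theorem quarticBump_zero : quarticBump 0 = 1 := by simp [quarticBump]

theorem quarticBump_eq_zero {s : ℝ} (hs : 1 ≤ |s|) : quarticBump s = 0 := by
  have : 1 ≤ s ^ 2 := by rw [← sq_abs]; nlinarith
  simp [quarticBump, this]

theorem quarticBumpDeriv_eq_zero {s : ℝ} (hs : 1 ≤ |s|) : quarticBumpDeriv s = 0 := by
  have : 1 ≤ s ^ 2 := by rw [← sq_abs]; nlinarith
  simp [quarticBumpDeriv, this]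

theorem quarticBump_nonneg (s : ℝ) : 0 ≤ quarticBump s := sq_nonneg _

theorem quarticBump_le_one (s : ℝ) : quarticBump s ≤ 1 := by
  have h : max (1 - s ^ 2) 0 ≤ 1 := max_le (by nlinarith) zero_le_one
  exact pow_le_one₀ (le_max_right _ _) h

theorem abs_quarticBumpDeriv_le (s : ℝ) : |quarticBumpDeriv s| ≤ 4 := by
  rcases le_total 1 |s| with hs | hs
  · simp [quarticBumpDeriv_eq_zero hs]
  · have h : max (1 - s ^ 2) 0 ≤ 1 := max_le (by nlinarith) zero_le_one
    rw [quarticBumpDeriv, abs_mul, abs_mul, abs_neg, abs_mul, abs_two,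
      abs_of_nonneg (le_max_right (1 - s ^ 2) 0)]
    nlinarith [abs_nonneg s, le_max_right (1 - s ^ 2) 0]

namespace C1Curve

variable {X : Type*} [NormedAddCommGroup X] [NormedSpace ℝ X]

theorem hasDerivAt_scaledBump (t L : ℝ) (v : X) (s : ℝ) :
    HasDerivAt (fun s => quarticBump ((s - t) / L) • v)
      ((quarticBumpDeriv ((s - t) / L) * (1 / L)) • v) s := by
  have h : HasDerivAt (fun s : ℝ => (s - t) / L) (1 / L) s :=
    ((hasDerivAt_id s).sub_const t).div_const L
  exact ((hasDerivAt_quarticBump _).comp s h).smul_const v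

/-- The curve with a bump of height `v` and radius `L` at time `t`. -/
noncomputable def bump (t L : ℝ) (v : X) : C1Curve X :=
  ofHasDerivAt _ _ (hasDerivAt_scaledBump t L v)
    (((continuous_quarticBumpDeriv.comp (by fun_prop)).mul continuous_const).smul
      continuous_const)

theorem ext_bump (t L : ℝ) (v : X) {s : ℝ} (hs : s ∈ Icc (0 : ℝ) 1) :
    ext (bump t L v) s = quarticBump ((s - t) / L) • v := ext_ofHasDerivAt _ _ hs

theorem dext_bump (t L : ℝ) (v : X) {s : ℝ} (hs : s ∈ Icc (0 : ℝ) 1) :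
    dext (bump t L v) s = (quarticBumpDeriv ((s - t) / L) * (1 / L)) • v :=
  dext_ofHasDerivAt _ _ hs

theorem one_le_abs_div {s t L : ℝ} (hL : 0 < L) (hs : L ≤ |s - t|) : 1 ≤ |(s - t) / L| := by
  rwa [abs_div, abs_of_pos hL, one_le_div hL]

theorem ext_bump_eq_zero {t L : ℝ} (v : X) (hL : 0 < L) {s : ℝ} (hs : s ∈ Icc (0 : ℝ) 1)
    (h : L ≤ |s - t|) : ext (bump t L v) s = 0 := by
  rw [ext_bump _ _ _ hs, quarticBump_eq_zero (one_le_abs_div hL h), zero_smul]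

theorem dext_bump_eq_zero {t L : ℝ} (v : X) (hL : 0 < L) {s : ℝ} (hs : s ∈ Icc (0 : ℝ) 1)
    (h : L ≤ |s - t|) : dext (bump t L v) s = 0 := by
  rw [dext_bump _ _ _ hs, quarticBumpDeriv_eq_zero (one_le_abs_div hL h), zero_mul, zero_smul]

theorem norm_ext_bump_le (t L : ℝ) (v : X) {s : ℝ} (hs : s ∈ Icc (0 : ℝ) 1) :
    ‖ext (bump t L v) s‖ ≤ ‖v‖ := by
  rw [ext_bump _ _ _ hs, norm_smul, Real.norm_of_nonneg (quarticBump_nonneg _)]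
  exact mul_le_of_le_one_left (norm_nonneg _) (quarticBump_le_one _)

theorem norm_dext_bump_le (t : ℝ) {L : ℝ} (hL : 0 < L) (v : X) {s : ℝ}
    (hs : s ∈ Icc (0 : ℝ) 1) : ‖dext (bump t L v) s‖ ≤ 4 * ‖v‖ / L := by
  rw [dext_bump _ _ _ hs, norm_smul, norm_mul, Real.norm_eq_abs, Real.norm_of_nonneg
    (one_div_nonneg.2 hL.le), mul_one_div, div_mul_eq_mul_div]
  gcongr
  exact abs_quarticBumpDeriv_le _

/-- The bump vanishes at both ends of its support. This mean-zero property cancels the first-order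
term in the energy. -/
theorem integral_dext_bump [CompleteSpace X] {t L : ℝ} (hL : 0 < L) (v : X)
    (hI : Metric.closedBall t L ⊆ Icc (0 : ℝ) 1) :
    ∫ s in Metric.closedBall t L, dext (bump t L v) s = 0 := by
  have hsub : uIcc (t - L) (t + L) ⊆ Icc (0 : ℝ) 1 := by
    rwa [uIcc_of_le (by linarith), ← Real.closedBall_eq_Icc]
  have h0 : t - L ≤ t + L := by linarith
  rw [Real.closedBall_eq_Icc, integral_Icc_eq_integral_Ioc, ← intervalIntegral.integral_of_le h0,
    intervalIntegral.integral_congr (fun s hs => dext_bump t L v (hsub hs)),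
    intervalIntegral.integral_eq_sub_of_hasDerivAt
      (fun s _ => hasDerivAt_scaledBump t L v s) (Continuous.intervalIntegrable
        (((continuous_quarticBumpDeriv.comp (by fun_prop)).mul continuous_const).smul
          continuous_const) _ _)]
  have e1 : (t + L - t) / L = 1 := by rw [add_sub_cancel_left, div_self hL.ne']
  have e2 : (t - L - t) / L = -1 := by rw [sub_sub_cancel_left, neg_div, div_self hL.ne']
  rw [e1, e2, quarticBump_eq_zero (by simp), quarticBump_eq_zero (by simp), sub_self]

/-! ### Time spent in a set, as a function of the curve -/

/-- The set of times in `[0,1]` which the curve spends in `A`. -/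
def times (γ : C1Curve X) (A : Set X) : Set ℝ := {t | t ∈ Icc (0 : ℝ) 1 ∧ ext γ t ∈ A}

theorem times_subset (γ : C1Curve X) (A : Set X) : times γ A ⊆ Icc 0 1 := fun _ h => h.1

theorem times_mono (γ : C1Curve X) {A B : Set X} (h : A ⊆ B) : times γ A ⊆ times γ B :=
  fun _ ht => ⟨ht.1, h ht.2⟩

theorem volume_times_le_one (γ : C1Curve X) (A : Set X) : volume (times γ A) ≤ 1 :=
  (measure_mono (times_subset γ A)).trans (by simp)

theorem volume_times_ne_top (γ : C1Curve X) (A : Set X) : volume (times γ A) ≠ ∞ :=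
  ((volume_times_le_one γ A).trans_lt ENNReal.one_lt_top).ne

theorem measurableSet_times_of_isOpen (γ : C1Curve X) {G : Set X} (hG : IsOpen G) :
    MeasurableSet (times γ G) :=
  measurableSet_Icc.inter (hG.preimage (continuous_ext γ)).measurableSet

theorem measurableSet_times_of_isClosed (γ : C1Curve X) {F : Set X} (hF : IsClosed F) :
    MeasurableSet (times γ F) :=
  measurableSet_Icc.inter (hF.preimage (continuous_ext γ)).measurableSet

/-- Exhaust the times in `G` by those at which a ball of radius `1 / (n + 1)` around the curve point
stays in `G`; every curve closer to `γ` than this radius is in `G` at all those times. -/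
theorem lowerSemicontinuous_volume_times {G : Set X} (hG : IsOpen G) :
    LowerSemicontinuous fun γ : C1Curve X => volume (times γ G) := by
  intro γ a ha
  let V : ℕ → Set ℝ := fun n => {t | t ∈ Icc (0 : ℝ) 1 ∧
    Metric.ball (ext γ t) (1 / (n + 1 : ℝ)) ⊆ G}
  have hV : times γ G = ⋃ n, V n := by
    ext t
    simp only [mem_iUnion]
    constructor
    · rintro ⟨ht, htG⟩
      obtain ⟨ε, hε, hb⟩ := Metric.isOpen_iff.1 hG _ htG
      obtain ⟨n, hn⟩ := exists_nat_one_div_lt hε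
      exact ⟨n, ht, (Metric.ball_subset_ball hn.le).trans hb⟩
    · rintro ⟨n, ht, hb⟩
      exact ⟨ht, hb (Metric.mem_ball_self (by positivity))⟩
  have hmono : Monotone V := fun m n hmn t ht =>
    ⟨ht.1, (Metric.ball_subset_ball (by gcongr)).trans ht.2⟩
  have ha' : a < volume (times γ G) := ha
  have hlim := tendsto_measure_iUnion_atTop (μ := volume) hmono
  rw [← hV] at hlim
  obtain ⟨n, hn⟩ := (hlim.eventually (lt_mem_nhds ha')).exists
  filter_upwards [Metric.ball_mem_nhds γ (show (0 : ℝ) < 1 / (n + 1 : ℝ) by positivity)] with δ hδ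
  refine lt_of_lt_of_le hn (measure_mono fun t ht => ⟨ht.1, ht.2 ?_⟩)
  rw [mem_ball_iff_norm] at hδ ⊢
  exact ((norm_ext_le (δ - γ) t).trans (norm_curve_le _)).trans_lt hδ

/-- The value is an infimum of differences of two occupation times of open sets, each lower
semicontinuous and hence Borel. -/
theorem measurable_volume_times [MeasurableSpace (C1Curve X)] [BorelSpace (C1Curve X)]
    {F : Set X} (hF : IsClosed F) {U : ℕ → Set X} (hU : ∀ n, IsOpen (U n)) (hUa : Antitone U) :
    Measurable fun γ : C1Curve X => volume (times γ (F ∩ ⋂ n, U n)) := by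
  have h : (fun γ : C1Curve X => volume (times γ (F ∩ ⋂ n, U n))) = fun γ =>
      ⨅ n, (volume (times γ (U n)) - volume (times γ (U n ∩ Fᶜ))) := by
    ext γ
    have e1 : times γ (F ∩ ⋂ n, U n) = ⋂ n, times γ (U n) \ times γ (U n ∩ Fᶜ) := by
      ext t
      simp only [times, mem_inter_iff, mem_ofPred_eq, mem_iInter, Set.mem_sdiff, mem_compl_iff]
      constructor
      · rintro ⟨h1, h2, h3⟩ n
        exact ⟨⟨h1, h3 n⟩, fun h => h.2.2 h2⟩
      · intro h
        refine ⟨(h 0).1.1, ?_, fun n => (h n).1.2⟩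
        by_contra hF'
        exact (h 0).2 ⟨(h 0).1.1, (h 0).1.2, hF'⟩
    have hm : ∀ n, MeasurableSet (times γ (U n ∩ Fᶜ)) := fun n =>
      measurableSet_times_of_isOpen γ ((hU n).inter hF.isOpen_compl)
    rw [e1, Antitone.measure_iInter]
    · congr 1; ext n
      rw [measure_sdiff (times_mono γ inter_subset_left) (hm n).nullMeasurableSet
        (volume_times_ne_top γ _)]
    · intro m n hmn t ht
      exact ⟨times_mono γ (hUa hmn) ht.1, fun h => ht.2 ⟨h.1, ht.1.2, h.2.2⟩⟩
    · exact fun n => ((measurableSet_times_of_isOpen γ (hU n)).diff (hm n)).nullMeasurableSet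
    · exact ⟨0, ((measure_mono sdiff_subset).trans_lt
        (lt_top_iff_ne_top.2 (volume_times_ne_top γ (U 0)))).ne⟩
  rw [h]
  exact Measurable.iInf fun n => (lowerSemicontinuous_volume_times (hU n)).measurable.sub
    (lowerSemicontinuous_volume_times ((hU n).inter hF.isOpen_compl)).measurable

/-- Upper semicontinuity for closed sets, obtained from lower semicontinuity on the complement. -/
theorem eventually_volume_times_lt {F : Set X} (hF : IsClosed F) (γ : C1Curve X) {ε : ℝ}
    (hε : 0 < ε) :
    ∀ᶠ δ in 𝓝 γ, volume.real (times δ F) < volume.real (times γ F) + ε := by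
  have hsum : ∀ δ : C1Curve X, volume.real (times δ F) = 1 - volume.real (times δ Fᶜ) := by
    intro δ
    have h1 : times δ F = Icc 0 1 \ times δ Fᶜ := by
      ext t; simp only [times, Set.mem_sdiff, mem_ofPred_eq, mem_compl_iff]; tauto
    rw [h1, measureReal_sdiff (times_subset δ _)
      (measurableSet_times_of_isOpen δ hF.isOpen_compl) (by simp)]
    simp
  have hfin := volume_times_ne_top γ Fᶜ
  -- `ENNReal.ofReal` truncates negative numbers to zero, so this trivial case has to be treated
  -- separately.
  by_cases h0 : volume.real (times γ Fᶜ) - ε < 0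
  · filter_upwards with δ
    rw [hsum δ, hsum γ]
    linarith [measureReal_nonneg (μ := volume) (s := times δ Fᶜ)]
  · have := lowerSemicontinuous_volume_times hF.isOpen_compl γ
      (ENNReal.ofReal (volume.real (times γ Fᶜ) - ε))
      ((ENNReal.ofReal_lt_iff_lt_toReal (not_lt.1 h0) hfin).2 (sub_lt_self _ hε))
    filter_upwards [this] with δ hδ
    rw [gt_iff_lt, ENNReal.ofReal_lt_iff_lt_toReal (not_lt.1 h0) (volume_times_ne_top δ Fᶜ)] at hδ
    change _ < volume.real _ at hδ
    rw [hsum δ, hsum γ]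
    linarith

/-! ### The energy of a curve -/

/-- The energy `∫₀¹ ‖γ'‖²`. -/
noncomputable def energy (γ : C1Curve X) : ℝ := ∫ s in Icc (0 : ℝ) 1, ‖dext γ s‖ ^ 2

theorem energy_nonneg (γ : C1Curve X) : 0 ≤ energy γ := integral_nonneg fun _ => by positivity

@[simp] theorem energy_zero : energy (0 : C1Curve X) = 0 := by
  have h : ∀ s, dext (0 : C1Curve X) s = 0 := fun s => rfl
  simp [energy, h]

theorem continuous_energy : Continuous (energy : C1Curve X → ℝ) := by
  have : (energy : C1Curve X → ℝ) = fun γ => ∫ s in (0 : ℝ)..1, ‖dext γ s‖ ^ 2 := by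
    ext γ
    rw [energy, integral_Icc_eq_integral_Ioc, intervalIntegral.integral_of_le zero_le_one]
  rw [this]
  refine intervalIntegral.continuous_parametric_intervalIntegral_of_continuous' ?_ 0 1
  refine Continuous.pow (Continuous.norm ?_) 2
  exact ContinuousEval.continuous_eval.comp ((continuous_deriv.comp continuous_fst).prodMk
    ((continuous_projIcc (h := zero_le_one' ℝ)).comp continuous_snd))

theorem integrableOn_norm_dext_sq (γ : C1Curve X) :
    IntegrableOn (fun s => ‖dext γ s‖ ^ 2) (Icc 0 1) :=
  ((continuous_dext γ).norm.pow 2).continuousOn.integrableOn_Icc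

/-- Chebyshev's inequality for the derivative. -/
theorem mul_volume_le_energy (γ : C1Curve X) {a : ℝ} (ha : 0 ≤ a) :
    a ^ 2 * volume.real {t | t ∈ Icc (0 : ℝ) 1 ∧ a ≤ ‖dext γ t‖} ≤ energy γ := by
  have h := mul_meas_ge_le_integral_of_nonneg (μ := volume.restrict (Icc (0 : ℝ) 1))
    (f := fun s => ‖dext γ s‖ ^ 2) (Eventually.of_forall fun s => by positivity)
    (integrableOn_norm_dext_sq γ) (a ^ 2)
  refine le_trans (le_of_eq ?_) h
  rw [measureReal_restrict_apply' measurableSet_Icc]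
  congr 2
  ext t
  simp only [mem_ofPred_eq, mem_inter_iff, sq_le_sq₀ ha (norm_nonneg _)]
  tauto

end C1Curve

/-! ### Splitting integrals and measures along disjoint pieces -/

section Decomposition

variable {ι : Type*} (s : Finset ι) {B : ι → Set ℝ}

theorem setIntegral_eq_sum_add_sdiff (hB : ∀ i ∈ s, MeasurableSet (B i))
    (hd : (s : Set ι).PairwiseDisjoint B) {I : Set ℝ}
    (hI : ∀ i ∈ s, B i ⊆ I) {f : ℝ → ℝ} (hf : IntegrableOn f I) :
    ∫ x in I, f x = (∑ i ∈ s, ∫ x in B i, f x) + ∫ x in I \ ⋃ i ∈ s, B i, f x := by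
  have hW : MeasurableSet (⋃ i ∈ s, B i) := s.measurableSet_biUnion hB
  have hsub : (⋃ i ∈ s, B i) ⊆ I := iUnion₂_subset hI
  rw [← integral_biUnion_finset s hB hd fun i hi => hf.mono_set (hI i hi),
    ← integral_inter_add_sdiff hW hf, inter_eq_self_of_subset_right hsub]

theorem measureReal_eq_sum_add_sdiff (hB : ∀ i ∈ s, MeasurableSet (B i))
    (hd : (s : Set ι).PairwiseDisjoint B) {T : Set ℝ}
    (hT : MeasurableSet T) (hfin : volume T ≠ ∞) :
    volume.real T = (∑ i ∈ s, volume.real (T ∩ B i)) + volume.real (T \ ⋃ i ∈ s, B i) := by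
  have hW : MeasurableSet (⋃ i ∈ s, B i) := s.measurableSet_biUnion hB
  rw [← measureReal_inter_add_sdiff (s := T) hW hfin, inter_iUnion₂, measureReal_biUnion_finset
    (fun i hi j hj hij => (hd hi hj hij).mono inter_subset_right inter_subset_right)
    (fun i hi => hT.inter (hB i hi))
    (fun i _ => ((measure_mono inter_subset_left).trans_lt (lt_top_iff_ne_top.2 hfin)).ne)]

end Decomposition

/-! ### Energy growth under a mean-zero perturbation -/

section Energy

variable {H : Type*} [NormedAddCommGroup H] [InnerProductSpace ℝ H]

/-- An increment with zero mean is almost orthogonal to a function with small oscillation. -/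
theorem setIntegral_norm_add_sq_le [CompleteSpace H] {u p : ℝ → H} {t L σ : ℝ} (hL : 0 < L)
    (hu : ContinuousOn u (Metric.closedBall t L)) (hp : ContinuousOn p (Metric.closedBall t L))
    (huσ : ∀ s ∈ Metric.closedBall t L, ‖u s - u t‖ ≤ σ / 2)
    (hpσ : ∀ s ∈ Metric.closedBall t L, ‖p s‖ ≤ σ)
    (h0 : ∫ s in Metric.closedBall t L, p s = 0) :
    ∫ s in Metric.closedBall t L, ‖u s + p s‖ ^ 2 ≤
      (∫ s in Metric.closedBall t L, ‖u s‖ ^ 2) + 4 * L * σ ^ 2 := by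
  have hK : IsCompact (Metric.closedBall t L) := isCompact_closedBall t L
  have iu : IntegrableOn (fun s => ‖u s‖ ^ 2) (Metric.closedBall t L) :=
    (hu.norm.pow 2).integrableOn_compact hK
  have iup : IntegrableOn (fun s => ‖u s + p s‖ ^ 2) (Metric.closedBall t L) :=
    ((hu.add hp).norm.pow 2).integrableOn_compact hK
  have ip : IntegrableOn p (Metric.closedBall t L) := hp.integrableOn_compact hK
  have ii : IntegrableOn (fun s => inner ℝ (u t) (p s)) (Metric.closedBall t L) :=
    (continuousOn_const.inner hp).integrableOn_compact hK
  have ic : IntegrableOn (fun _ : ℝ => 2 * σ ^ 2) (Metric.closedBall t L) :=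
    continuousOn_const.integrableOn_compact hK
  -- Replacing `u s` by the constant `u t` makes the cross term vanish; the error contributes at
  -- most `σ ^ 2` pointwise to twice the inner product, and `‖p s‖ ^ 2` another `σ ^ 2`.
  have hz : ∫ s in Metric.closedBall t L, inner ℝ (u t) (p s) = 0 := by
    rw [integral_inner ip (u t), h0, inner_zero_right]
  have hmono : ∫ s in Metric.closedBall t L, ‖u s + p s‖ ^ 2 ≤
      ∫ s in Metric.closedBall t L, (‖u s‖ ^ 2 + 2 * inner ℝ (u t) (p s) + 2 * σ ^ 2) := by
    refine setIntegral_mono_on iup ((iu.add (ii.const_mul 2)).add ic)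
      Metric.isClosed_closedBall.measurableSet fun s hs => ?_
    have h1 : inner ℝ (u s) (p s) = inner ℝ (u t) (p s) + inner ℝ (u s - u t) (p s) := by
      rw [← inner_add_left]; congr 1; abel
    have h2 : inner ℝ (u s - u t) (p s) ≤ σ / 2 * σ :=
      (real_inner_le_norm _ _).trans (mul_le_mul (huσ s hs) (hpσ s hs) (norm_nonneg _)
        ((norm_nonneg _).trans (huσ s hs)))
    have h3 : ‖p s‖ ^ 2 ≤ σ ^ 2 := pow_le_pow_left₀ (norm_nonneg _) (hpσ s hs) 2
    rw [norm_add_sq_real, h1]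
    nlinarith
  have hvol : volume.real (Metric.closedBall t L) = 2 * L := by
    rw [measureReal_def, Real.volume_closedBall, ENNReal.toReal_ofReal (by linarith)]
  refine hmono.trans (le_of_eq ?_)
  have ia : IntegrableOn (fun s => ‖u s‖ ^ 2 + 2 * inner ℝ (u t) (p s))
    (Metric.closedBall t L) := iu.add (ii.const_mul 2)
  rw [integral_add ia ic, integral_add iu (ii.const_mul 2), integral_const_mul, hz, setIntegral_const, hvol, smul_eq_mul]
  ring

end Energy

/-! ### Bending a curve into holes -/

namespace C1Curve

variable {H : Type*} [NormedAddCommGroup H] [InnerProductSpace ℝ H]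

/-- On the interval of radius `L` around `t` the curve `γ` can be bent by the vector `v` into a
hole of `F`, with slope at most `σ`, staying `τ`-close to `γ₀`. -/
structure IsBendable (F : Set H) (c τ σ θ : ℝ) (γ₀ γ : C1Curve H) (t L : ℝ) (v : H) : Prop where
  pos : 0 < L
  closedBall_subset : Metric.closedBall t L ⊆ Icc (0 : ℝ) 1
  norm_eq : ‖v‖ = σ * L / 4
  density : (1 - θ) * (2 * L) ≤ volume.real (times γ F ∩ Metric.closedBall t L)
  hole : Disjoint (Metric.ball (ext γ t + v) (c * ‖v‖)) F
  oscillation : ∀ s ∈ Metric.closedBall t L, ‖dext (γ - γ₀) s - dext (γ - γ₀) t‖ ≤ σ / 2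
  norm_center_lt : ‖dext (γ - γ₀) t‖ < τ / 4
  norm_lt : ‖v‖ < τ - ‖curve (γ - γ₀)‖

/-- All requirements except the hole hold for every sufficiently small `L`. The hole dictates `L`,
through `‖v‖ = σ * L / 4`, and holes occur at arbitrarily small distances. -/
theorem exists_isBendable {F : Set H} {c τ σ θ : ℝ} (hσ : 0 < σ) (hθ : 0 < θ)
    {γ₀ γ : C1Curve H} (hγ : ‖curve (γ - γ₀)‖ < τ) {t : ℝ} (ht : t ∈ Ioo (0 : ℝ) 1)
    (hhole : ∀ δ > 0, ∃ h : H, 0 < ‖h - ext γ t‖ ∧ ‖h - ext γ t‖ < δ ∧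
      Disjoint (Metric.ball h (c * ‖h - ext γ t‖)) F)
    (hcenter : ‖dext (γ - γ₀) t‖ < τ / 4)
    (hdens : Tendsto (fun r => volume (times γ F ∩ Metric.closedBall t r) /
      volume (Metric.closedBall t r)) (𝓝[>] 0) (𝓝 1)) {δ : ℝ} (hδ : 0 < δ) :
    ∃ L ∈ Ioo 0 δ, ∃ v, IsBendable F c τ σ θ γ₀ γ t L v := by
  have e1 : ∀ᶠ L in 𝓝[>] (0 : ℝ), Metric.closedBall t L ⊆ Icc (0 : ℝ) 1 :=
    nhdsWithin_le_nhds (eventually_closedBall_subset (Icc_mem_nhds ht.1 ht.2))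
  have e2 : ∀ᶠ L in 𝓝[>] (0 : ℝ), (1 - θ) * (2 * L) ≤
      volume.real (times γ F ∩ Metric.closedBall t L) := by
    have h1 : ENNReal.ofReal (1 - θ) < 1 := by
      rw [ENNReal.ofReal_lt_one]; linarith
    filter_upwards [hdens.eventually (lt_mem_nhds h1), self_mem_nhdsWithin] with L hL hL0
    have hL0 : 0 < L := hL0
    rw [Real.volume_closedBall, ENNReal.lt_div_iff_mul_lt (Or.inl (by simpa using hL0))
      (Or.inl ENNReal.ofReal_ne_top), ← ENNReal.ofReal_mul' (by linarith)] at hL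
    exact (ENNReal.ofReal_le_iff_le_toReal
      ((measure_mono inter_subset_left).trans_lt
        (lt_top_iff_ne_top.2 (volume_times_ne_top γ F))).ne).1 hL.le
  have e3 : ∀ᶠ L in 𝓝[>] (0 : ℝ), ∀ s ∈ Metric.closedBall t L,
      ‖dext (γ - γ₀) s - dext (γ - γ₀) t‖ ≤ σ / 2 := by
    have := Metric.continuousAt_iff.1 ((continuous_dext (γ - γ₀)).continuousAt (x := t)) (σ / 2) (by linarith)
    obtain ⟨η, hη, h⟩ := this
    filter_upwards [nhdsWithin_le_nhds (gt_mem_nhds hη)] with L hL s hs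
    rw [← dist_eq_norm]
    exact (h ((Metric.mem_closedBall.1 hs).trans_lt hL)).le
  have hd : ∀ᶠ L in 𝓝[>] (0 : ℝ), L < δ := nhdsWithin_le_nhds (gt_mem_nhds hδ)
  have e4 : ∀ᶠ L in 𝓝[>] (0 : ℝ), L < 4 * (τ - ‖curve (γ - γ₀)‖) / σ :=
    nhdsWithin_le_nhds (gt_mem_nhds (by have := sub_pos.2 hγ; positivity))
  obtain ⟨η, hη, h⟩ := mem_nhdsGT_iff_exists_Ioo_subset.1
    (e1.and (e2.and (e3.and (hd.and e4))))
  have hη : 0 < η := hη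
  -- The bound `σ * η / 4` is what puts the forced radius `4 * ‖x - ext γ t‖ / σ` below `η`.
  obtain ⟨x, hx0, hxη, hx⟩ := hhole (σ * η / 4) (by positivity)
  have hL0 : 0 < 4 * ‖x - ext γ t‖ / σ := by positivity
  obtain ⟨h1, h2, h3, h4, h5⟩ := h (show 4 * ‖x - ext γ t‖ / σ ∈ Ioo 0 η from
    ⟨hL0, by rw [div_lt_iff₀ hσ]; linarith⟩)
  refine ⟨_, ⟨hL0, h4⟩, x - ext γ t, hL0, h1, by field_simp, h2, by simpa using hx, h3,
    hcenter, ?_⟩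
  rw [div_lt_div_iff_of_pos_right hσ] at h5
  linarith

section Bend

variable {F : Set H} {c τ σ θ : ℝ} {γ₀ γ : C1Curve H} (s : Finset ℝ) {L : ℝ → ℝ} {v : ℝ → H}

/-- The curve `γ` with disjointly supported bumps added. -/
noncomputable def bend (γ : C1Curve H) (s : Finset ℝ) (L : ℝ → ℝ) (v : ℝ → H) : C1Curve H :=
  γ + ∑ t ∈ s, bump t (L t) (v t)

theorem le_abs_sub_of_notMem_closedBall {x t r : ℝ} (h : x ∉ Metric.closedBall t r) :
    r ≤ |x - t| := by
  rw [Metric.mem_closedBall, Real.dist_eq, not_le] at h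
  exact h.le

theorem bend_of_mem (hL : ∀ t ∈ s, 0 < L t)
    (hd : (s : Set ℝ).PairwiseDisjoint fun t => Metric.closedBall t (L t))
    {t : ℝ} (ht : t ∈ s) {x : ℝ} (hx : x ∈ Metric.closedBall t (L t)) (hx1 : x ∈ Icc (0 : ℝ) 1) :
    ext (bend γ s L v) x = ext γ x + ext (bump t (L t) (v t)) x ∧
      dext (bend γ s L v) x = dext γ x + dext (bump t (L t) (v t)) x := by
  have h : ∀ t' ∈ s, t' ≠ t → L t' ≤ |x - t'| := fun t' ht' hne =>
    le_abs_sub_of_notMem_closedBall fun hx' => (hd ht' ht hne).le_bot ⟨hx', hx⟩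
  rw [bend, ext_add, dext_add, ext_sum, dext_sum, Finset.sum_eq_single_of_mem t ht
    fun t' ht' hne => ext_bump_eq_zero _ (hL t' ht') hx1 (h t' ht' hne),
    Finset.sum_eq_single_of_mem t ht
    fun t' ht' hne => dext_bump_eq_zero _ (hL t' ht') hx1 (h t' ht' hne)]
  exact ⟨rfl, rfl⟩

theorem bend_of_notMem (hL : ∀ t ∈ s, 0 < L t) {x : ℝ}
    (hx : x ∉ ⋃ t ∈ s, Metric.closedBall t (L t)) (hx1 : x ∈ Icc (0 : ℝ) 1) :
    ext (bend γ s L v) x = ext γ x ∧ dext (bend γ s L v) x = dext γ x := by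
  have h : ∀ t' ∈ s, L t' ≤ |x - t'| := fun t' ht' =>
    le_abs_sub_of_notMem_closedBall fun hx' => hx (mem_biUnion ht' hx')
  rw [bend, ext_add, dext_add, ext_sum, dext_sum, Finset.sum_eq_zero
    fun t' ht' => ext_bump_eq_zero _ (hL t' ht') hx1 (h t' ht'), Finset.sum_eq_zero
    fun t' ht' => dext_bump_eq_zero _ (hL t' ht') hx1 (h t' ht')]
  exact ⟨add_zero _, add_zero _⟩

theorem IsBendable.norm_dext_bump_le {t r : ℝ} {w : H}
    (h : IsBendable F c τ σ θ γ₀ γ t r w) {x : ℝ} (hx : x ∈ Icc (0 : ℝ) 1) :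
    ‖dext (bump t r w) x‖ ≤ σ := by
  refine (C1Curve.norm_dext_bump_le t h.pos w hx).trans (le_of_eq ?_)
  rw [h.norm_eq]
  have := h.pos
  field_simp

theorem norm_curve_bend_sub_lt (hτ : 0 < τ) (hγ : ‖curve (γ - γ₀)‖ < τ)
    (hs : ∀ t ∈ s, IsBendable F c τ σ θ γ₀ γ t (L t) (v t))
    (hd : (s : Set ℝ).PairwiseDisjoint fun t => Metric.closedBall t (L t)) :
    ‖curve (bend γ s L v - γ₀)‖ < τ := by
  refine (ContinuousMap.norm_lt_iff _ hτ).2 fun x => ?_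
  rw [← ext_of_mem _ x.2, ext_sub]
  by_cases hx : (x : ℝ) ∈ ⋃ t ∈ s, Metric.closedBall t (L t)
  · simp only [mem_iUnion] at hx
    obtain ⟨t, ht, hxt⟩ := hx
    rw [(bend_of_mem s (fun t ht => (hs t ht).pos) hd ht hxt x.2).1, add_sub_right_comm,
      ← ext_sub]
    have h1 := norm_ext_le (γ - γ₀) x
    have h2 := norm_ext_bump_le t (L t) (v t) x.2
    have h3 := (hs t ht).norm_lt
    exact (norm_add_le _ _).trans_lt (by linarith)
  · rw [(bend_of_notMem s (fun t ht => (hs t ht).pos) hx x.2).1, ← ext_sub]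
    exact (norm_ext_le _ _).trans_lt hγ

/-- On a bent interval the deviation from `γ₀` is below `τ / 4` at the centre, oscillates by at most
`σ / 2 ≤ τ / 8` and gains at most `σ ≤ τ / 4`. This is why the centres must have small derivative
deviation. -/
theorem norm_deriv_bend_sub_lt (hτ : 0 < τ) (hσ : σ ≤ τ / 4) (hγ : ‖deriv (γ - γ₀)‖ < τ)
    (hs : ∀ t ∈ s, IsBendable F c τ σ θ γ₀ γ t (L t) (v t))
    (hd : (s : Set ℝ).PairwiseDisjoint fun t => Metric.closedBall t (L t)) :
    ‖deriv (bend γ s L v - γ₀)‖ < τ := by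
  refine (ContinuousMap.norm_lt_iff _ hτ).2 fun x => ?_
  rw [← dext_of_mem _ x.2, dext_sub]
  by_cases hx : (x : ℝ) ∈ ⋃ t ∈ s, Metric.closedBall t (L t)
  · simp only [mem_iUnion] at hx
    obtain ⟨t, ht, hxt⟩ := hx
    rw [(bend_of_mem s (fun t ht => (hs t ht).pos) hd ht hxt x.2).2, add_sub_right_comm,
      ← dext_sub]
    have h1 := (hs t ht).oscillation x hxt
    have h2 := (hs t ht).norm_dext_bump_le x.2
    have h3 := (hs t ht).norm_center_lt
    have h4 := norm_le_norm_add_norm_sub' (dext (γ - γ₀) x) (dext (γ - γ₀) t)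
    exact (norm_add_le _ _).trans_lt (by linarith)
  · rw [(bend_of_notMem s (fun t ht => (hs t ht).pos) hx x.2).2, ← dext_sub]
    exact (norm_dext_le _ _).trans_lt hγ

/-- Nothing changes off the intervals, and on each of them `setIntegral_norm_add_sq_le` applies with
`p` the derivative of the bump. -/
theorem energy_bend_sub_le [CompleteSpace H]
    (hs : ∀ t ∈ s, IsBendable F c τ σ θ γ₀ γ t (L t) (v t))
    (hd : (s : Set ℝ).PairwiseDisjoint fun t => Metric.closedBall t (L t)) :
    energy (bend γ s L v - γ₀) ≤ energy (γ - γ₀) + ∑ t ∈ s, 4 * L t * σ ^ 2 := by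
  have hB : ∀ t ∈ s, MeasurableSet (Metric.closedBall t (L t)) := fun t _ =>
    Metric.isClosed_closedBall.measurableSet
  have hI := fun t ht => (hs t ht).closedBall_subset
  have hL := fun t ht => (hs t ht).pos
  rw [energy, energy, setIntegral_eq_sum_add_sdiff s hB hd hI (integrableOn_norm_dext_sq _),
    setIntegral_eq_sum_add_sdiff s hB hd hI (integrableOn_norm_dext_sq (γ - γ₀)),
    add_right_comm, ← Finset.sum_add_distrib]
  refine add_le_add (Finset.sum_le_sum fun t ht => ?_) (le_of_eq ?_)
  · rw [setIntegral_congr_fun (g := fun x => ‖dext (γ - γ₀) x + dext (bump t (L t) (v t)) x‖ ^ 2)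
      (hB t ht) fun x hx => by
        simp only [dext_sub, (bend_of_mem s hL hd ht hx (hI t ht hx)).2, add_sub_right_comm]]
    exact setIntegral_norm_add_sq_le (hL t ht) (continuous_dext _).continuousOn
      (continuous_dext _).continuousOn (hs t ht).oscillation
      (fun x hx => (hs t ht).norm_dext_bump_le (hI t ht hx))
      (integral_dext_bump (hL t ht) _ (hI t ht))
  · refine setIntegral_congr_fun (measurableSet_Icc.diff (s.measurableSet_biUnion hB)) ?_
    intro x hx
    simp only [dext_sub, (bend_of_notMem s hL hx.2 hx.1).2]

/-- At the centre `t` the bent curve sits at the centre of a hole of radius `c * ‖v t‖ = c * σ * L t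
/ 4`. Being `M`-Lipschitz, it avoids `F` for times within `c * σ * L t / (4 * M)` of `t`. The choice
of `θ` lets the density defect of `γ` consume exactly half of the length so gained. -/
theorem volume_times_bend_le (hF : IsClosed F) {M : ℝ} (hM : 0 < M) (hc : 0 < c) (hσ : 0 < σ)
    (hcσ : c * σ ≤ 4 * M) (hθ : θ = c * σ / (8 * M))
    (hbM : ‖deriv (bend γ s L v)‖ ≤ M)
    (hs : ∀ t ∈ s, IsBendable F c τ σ θ γ₀ γ t (L t) (v t))
    (hd : (s : Set ℝ).PairwiseDisjoint fun t => Metric.closedBall t (L t)) :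
    volume.real (times (bend γ s L v) F) + ∑ t ∈ s, c * σ * L t / (4 * M) ≤
      volume.real (times γ F) := by
  have hB : ∀ t ∈ s, MeasurableSet (Metric.closedBall t (L t)) := fun t _ =>
    Metric.isClosed_closedBall.measurableSet
  have hI := fun t ht => (hs t ht).closedBall_subset
  have hL := fun t ht => (hs t ht).pos
  rw [measureReal_eq_sum_add_sdiff s hB hd (measurableSet_times_of_isClosed _ hF)
    (volume_times_ne_top _ _), measureReal_eq_sum_add_sdiff s hB hd
    (measurableSet_times_of_isClosed γ hF) (volume_times_ne_top _ _),
    add_right_comm, ← Finset.sum_add_distrib]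
  refine add_le_add (Finset.sum_le_sum fun t ht => ?_) (le_of_eq ?_)
  · have hLt := hL t ht
    refine le_trans ?_ (hs t ht).density
    have hρ : 0 ≤ c * σ * L t / (4 * M) := by positivity
    have hρL : c * σ * L t / (4 * M) ≤ L t := by
      rw [div_le_iff₀ (by positivity)]; nlinarith
    have htI : t ∈ Icc (0 : ℝ) 1 := hI t ht (Metric.mem_closedBall_self hLt.le)
    have hcen : ext (bend γ s L v) t = ext γ t + v t := by
      rw [(bend_of_mem s hL hd ht (Metric.mem_closedBall_self hLt.le) htI).1, ext_bump _ _ _ htI]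
      simp
    have hsub : times (bend γ s L v) F ∩ Metric.closedBall t (L t) ⊆
        Metric.closedBall t (L t) \ Metric.ball t (c * σ * L t / (4 * M)) := by
      rintro x ⟨⟨hx1, hxF⟩, hxt⟩
      refine ⟨hxt, fun hxb => (hs t ht).hole.le_bot ⟨?_, hxF⟩⟩
      rw [Metric.mem_ball, Real.dist_eq] at hxb
      rw [mem_ball_iff_norm, ← hcen]
      refine (norm_ext_sub_le _ hx1 htI).trans_lt ?_
      calc ‖deriv (bend γ s L v)‖ * |x - t| ≤ M * |x - t| := by gcongr
        _ < M * (c * σ * L t / (4 * M)) := by gcongr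
        _ = c * ‖v t‖ := by rw [(hs t ht).norm_eq]; field_simp
    have hvol := measureReal_mono (μ := volume) hsub
      ((measure_mono sdiff_subset).trans_lt measure_closedBall_lt_top).ne
    rw [measureReal_sdiff (Metric.ball_subset_closedBall.trans (Metric.closedBall_subset_closedBall
      hρL)) Metric.isOpen_ball.measurableSet measure_closedBall_lt_top.ne,
      measureReal_def, measureReal_def, measureReal_def, Real.volume_closedBall, Real.volume_ball,
      ENNReal.toReal_ofReal (by positivity), ENNReal.toReal_ofReal (by positivity)] at hvol
    rw [measureReal_def]
    have : θ * (2 * L t) = c * σ * L t / (4 * M) := by rw [hθ]; field_simp; ring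
    linarith
  · congr 1
    ext x
    simp only [times, Set.mem_sdiff, mem_ofPred_eq]
    constructor
    · rintro ⟨⟨h1, h2⟩, h3⟩
      exact ⟨⟨h1, by rwa [← (bend_of_notMem s hL h3 h1 (γ := γ) (v := v)).1]⟩, h3⟩
    · rintro ⟨⟨h1, h2⟩, h3⟩
      exact ⟨⟨h1, by rwa [(bend_of_notMem s hL h3 h1).1]⟩, h3⟩

end Bend

end C1Curve

/-! ### The variational contradiction -/

namespace C1Curve

/-- `F` has `c`-holes at the point `x`, at arbitrarily small positive distances. -/
def HasHolesAt {X : Type*} [NormedAddCommGroup X] (c : ℝ) (F : Set X) (x : X) : Prop :=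
  ∀ δ > 0, ∃ h : X, 0 < ‖h - x‖ ∧ ‖h - x‖ < δ ∧ Disjoint (Metric.ball h (c * ‖h - x‖)) F

variable {H : Type*} [NormedAddCommGroup H] [InnerProductSpace ℝ H]

/-- Almost all times in question are density points of the closed set `times γ F`, so bendable
intervals of arbitrarily small radius are centred there. Besicovitch's theorem extracts a disjoint
family covering almost all of them, and a finite part keeps half the length. -/
theorem exists_finset_isBendable {F A : Set H} (hF : IsClosed F) (hAF : A ⊆ F)
    {c τ σ θ q : ℝ} (hA : ∀ x ∈ A, HasHolesAt c F x) (hσ : 0 < σ) (hθ : 0 < θ)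
    {γ₀ γ : C1Curve H} (hγ : ‖curve (γ - γ₀)‖ < τ) (hq : 0 < q)
    (hvol : ENNReal.ofReal q ≤
      volume {t | t ∈ times γ A ∧ ‖dext (γ - γ₀) t‖ < τ / 4}) :
    ∃ (s : Finset ℝ) (L : ℝ → ℝ) (v : ℝ → H),
      (∀ t ∈ s, IsBendable F c τ σ θ γ₀ γ t (L t) (v t)) ∧
      ((s : Set ℝ).PairwiseDisjoint fun t => Metric.closedBall t (L t)) ∧
      q / 2 ≤ ∑ t ∈ s, 2 * L t := by
  classical
  have hdens := (ae_restrict_iff' (measurableSet_times_of_isClosed γ hF)).1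
    (Besicovitch.ae_tendsto_measure_inter_div volume (times γ F))
  have hends : ∀ᵐ t : ℝ, t ∉ ({0, 1} : Set ℝ) :=
    measure_eq_zero_iff_ae_notMem.1 ((Set.toFinite ({0, 1} : Set ℝ)).measure_zero volume)
  set G : Set ℝ := {t | t ∈ times γ A ∧ ‖dext (γ - γ₀) t‖ < τ / 4 ∧ t ∈ Ioo (0 : ℝ) 1 ∧
    Tendsto (fun r => volume (times γ F ∩ Metric.closedBall t r) /
      volume (Metric.closedBall t r)) (𝓝[>] 0) (𝓝 1)}
  have hvolG : ENNReal.ofReal q ≤ volume G := by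
    refine hvol.trans (measure_mono_ae ?_)
    filter_upwards [hdens, hends] with t h1 h2 h3
    have h3 : t ∈ times γ A ∧ ‖dext (γ - γ₀) t‖ < τ / 4 := h3
    simp only [mem_insert_iff, mem_singleton_iff, not_or] at h2
    exact ⟨h3.1, h3.2, ⟨lt_of_le_of_ne h3.1.1.1 (Ne.symm h2.1), lt_of_le_of_ne h3.1.1.2 h2.2⟩,
      h1 (times_mono γ hAF h3.1)⟩
  obtain ⟨T, r, hTc, hTG, hTr, hnull, hdisj⟩ :=
    Besicovitch.exists_disjoint_closedBall_covering_ae volume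
      (fun t => {L | ∃ v, IsBendable F c τ σ θ γ₀ γ t L v}) G (fun t ht δ hδ => by
        obtain ⟨L, hL, hv⟩ := exists_isBendable hσ hθ hγ ht.2.2.1 (hA _ ht.1.2) ht.2.1
          ht.2.2.2 hδ
        exact ⟨L, hv, hL⟩) (fun _ => 1) (fun _ _ => one_pos)
  choose! v hv using fun t ht => (hTr t ht).1
  have hsum : ENNReal.ofReal q ≤ ∑' t : T, volume (Metric.closedBall (t : ℝ) (r t)) := by
    have h1 : volume G ≤ volume (⋃ t ∈ T, Metric.closedBall t (r t)) := by
      refine measure_mono_ae ?_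
      filter_upwards [measure_eq_zero_iff_ae_notMem.1 hnull] with t h1 h2
      by_contra h3
      exact h1 ⟨h2, h3⟩
    exact hvolG.trans (h1.trans (measure_biUnion_le _ hTc _))
  -- Halving makes the inequality strict, so some finite partial sum already exceeds `q / 2`.
  have hlt : ENNReal.ofReal (q / 2) < ∑' t : T, volume (Metric.closedBall (t : ℝ) (r t)) :=
    lt_of_lt_of_le ((ENNReal.ofReal_lt_ofReal_iff hq).2 (by linarith)) hsum
  rw [ENNReal.tsum_eq_iSup_sum, lt_iSup_iff] at hlt
  obtain ⟨s, hs⟩ := hlt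
  refine ⟨s.map (Function.Embedding.subtype _), r, v, ?_, ?_, ?_⟩
  · intro t ht
    obtain ⟨x, -, rfl⟩ := Finset.mem_map.1 ht
    exact hv x x.2
  · refine hdisj.subset ?_
    intro t ht
    obtain ⟨x, -, rfl⟩ := Finset.mem_map.1 (Finset.mem_coe.1 ht)
    exact x.2
  · rw [Finset.sum_map]
    simp only [Function.Embedding.subtype_apply]
    simp only [Real.volume_closedBall] at hs
    rw [← ENNReal.ofReal_sum_of_nonneg fun t _ => by have := (hv t t.2).pos; positivity] at hs
    exact (ENNReal.ofReal_lt_ofReal_iff_of_nonneg (by positivity)).1 hs |>.le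

/-- Points of `[0,1]` where the derivative is large can be discarded. -/
theorem ofReal_le_volume_of_energy_le {A : Set H} {γ₀ γ : C1Curve H} {τ q : ℝ} (hτ : 0 < τ)
    (hq : 0 < q) (hA : ENNReal.ofReal q ≤ volume (times γ A))
    (hE : energy (γ - γ₀) ≤ τ ^ 2 * q / 32) :
    ENNReal.ofReal (q / 2) ≤ volume {t | t ∈ times γ A ∧ ‖dext (γ - γ₀) t‖ < τ / 4} := by
  set B : Set ℝ := {t | t ∈ Icc (0 : ℝ) 1 ∧ τ / 4 ≤ ‖dext (γ - γ₀) t‖}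
  have hBfin : volume B ≠ ∞ :=
    ((measure_mono (fun t ht => ht.1 : B ⊆ Icc 0 1)).trans_lt measure_Icc_lt_top).ne
  have hB : volume B ≤ ENNReal.ofReal (q / 2) := by
    rw [ENNReal.le_ofReal_iff_toReal_le hBfin (by positivity)]
    have h := (mul_volume_le_energy (γ - γ₀) (a := τ / 4) (by positivity)).trans hE
    change (τ / 4) ^ 2 * volume.real B ≤ _ at h
    have h2 : (τ / 4) ^ 2 * volume.real B ≤ (τ / 4) ^ 2 * (q / 2) := h.trans (by
      rw [div_pow]; linarith)
    exact le_of_mul_le_mul_left h2 (by positivity)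
  have hsub : times γ A ⊆ {t | t ∈ times γ A ∧ ‖dext (γ - γ₀) t‖ < τ / 4} ∪ B := by
    intro t ht
    rcases lt_or_ge ‖dext (γ - γ₀) t‖ (τ / 4) with h | h
    · exact Or.inl ⟨ht, h⟩
    · exact Or.inr ⟨ht.1, h⟩
  have h := hA.trans ((measure_mono hsub).trans (measure_union_le _ _))
  have h2 : ENNReal.ofReal q = ENNReal.ofReal (q / 2) + ENNReal.ofReal (q / 2) := by
    rw [← ENNReal.ofReal_add (by positivity) (by positivity), add_halves]
  rw [h2] at h
  exact (ENNReal.add_le_add_iff_right ENNReal.ofReal_ne_top).1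
    (h.trans (add_le_add le_rfl hB))

/-- A closed set with `c`-holes at all points of `A` cannot have the property that the curves
spending a definite time in `A` are dense near some curve. -/
theorem not_forall_frequently_volume_times [CompleteSpace H] {F A : Set H} (hF : IsClosed F)
    (hAF : A ⊆ F) {c : ℝ} (hc : 0 < c) (hc1 : c < 1) (hA : ∀ x ∈ A, HasHolesAt c F x)
    (γ₀ : C1Curve H) {τ q : ℝ} (hτ : 0 < τ) (hq : 0 < q) :
    ¬ ∀ γ : C1Curve H, ‖curve (γ - γ₀)‖ < τ → ‖deriv (γ - γ₀)‖ < τ →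
      ∃ᶠ δ in 𝓝 γ, ENNReal.ofReal q ≤ volume (times δ A) := by
  intro hfreq
  -- Since `Φ γ < 2` will hold, this `K` gives energy at most `τ ^ 2 * q / 32`. By Chebyshev, the
  -- times with derivative deviation at least `τ / 4` then have measure at most `q / 2`.
  obtain ⟨K, hK⟩ : ∃ K, K = 64 / (τ ^ 2 * q) := ⟨_, rfl⟩
  have hK0 : 0 < K := by rw [hK]; positivity
  obtain ⟨M, hM⟩ : ∃ M, M = ‖deriv γ₀‖ + τ := ⟨_, rfl⟩
  have hMτ : τ ≤ M := by rw [hM]; linarith [norm_nonneg (deriv γ₀)]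
  have hM0 : 0 < M := hτ.trans_le hMτ
  -- The second bound makes the energy cost `K * (2 * σ ^ 2)` per unit length at most half of the
  -- gain `c * σ / (8 * M)`.
  obtain ⟨σ, hσ⟩ : ∃ σ, σ = min (τ / 4) (c / (32 * K * M)) := ⟨_, rfl⟩
  have hσ0 : 0 < σ := by rw [hσ]; positivity
  have hσ1 : σ ≤ τ / 4 := by rw [hσ]; exact min_le_left _ _
  have hσ2 : K * σ * (32 * M) ≤ c := by
    have : σ ≤ c / (32 * K * M) := by rw [hσ]; exact min_le_right _ _
    rw [le_div_iff₀ (by positivity)] at this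
    linarith
  obtain ⟨θ, hθ⟩ : ∃ θ, θ = c * σ / (8 * M) := ⟨_, rfl⟩
  have hθ0 : 0 < θ := by rw [hθ]; positivity
  set S : Set (C1Curve H) := {γ | ‖curve (γ - γ₀)‖ < τ ∧ ‖deriv (γ - γ₀)‖ < τ}
  have hSo : IsOpen S :=
    (isOpen_lt (continuous_curve.comp (continuous_id.sub continuous_const)).norm
      continuous_const).inter
    (isOpen_lt (continuous_deriv.comp (continuous_id.sub continuous_const)).norm continuous_const)
  set Φ : C1Curve H → ℝ := fun γ => volume.real (times γ F) + K * energy (γ - γ₀) with hΦ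
  have hΦ0 : ∀ γ, 0 ≤ Φ γ := fun γ =>
    add_nonneg measureReal_nonneg (mul_nonneg hK0.le (energy_nonneg _))
  have hbdd : BddBelow (Φ '' S) := ⟨0, by rintro _ ⟨γ, -, rfl⟩; exact hΦ0 γ⟩
  have h0S : γ₀ ∈ S := by
    have h1 : curve (γ₀ - γ₀) = 0 := sub_self (curve γ₀)
    have h2 : deriv (γ₀ - γ₀) = 0 := sub_self (deriv γ₀)
    exact ⟨by rw [h1, norm_zero]; exact hτ, by rw [h2, norm_zero]; exact hτ⟩
  have hm1 : sInf (Φ '' S) ≤ 1 := by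
    refine (csInf_le hbdd (mem_image_of_mem Φ h0S)).trans ?_
    simp only [hΦ, sub_self, energy_zero, mul_zero, add_zero]
    exact ENNReal.toReal_le_of_le_ofReal zero_le_one (by simpa using volume_times_le_one γ₀ F)
  -- The net decrease of `Φ` is at least `c * σ / (16 * M) * ℓ` with `ℓ ≥ q / 4`, hence at least
  -- `ε`.
  obtain ⟨ε, hε⟩ : ∃ ε, ε = min 1 (c * σ * q / (64 * M)) := ⟨_, rfl⟩
  have hε0 : 0 < ε := by rw [hε]; positivity
  have hε1 : ε ≤ 1 := by rw [hε]; exact min_le_left _ _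
  have hε2 : ε ≤ c * σ * q / (64 * M) := by rw [hε]; exact min_le_right _ _
  obtain ⟨_, ⟨γ₁, hγ₁, rfl⟩, hlt₁⟩ := exists_lt_of_csInf_lt (Set.Nonempty.image Φ ⟨γ₀, h0S⟩)
    (lt_add_of_pos_right (sInf (Φ '' S)) hε0)
  -- Membership in the open set `S` and the strict bound on the upper semicontinuous `Φ` persist
  -- near `γ₁`, so they can be combined with the density assumption.
  obtain ⟨γ, ⟨hγ, hlt⟩, hγA⟩ : ∃ γ, (γ ∈ S ∧ Φ γ < sInf (Φ '' S) + ε) ∧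
      ENNReal.ofReal q ≤ volume (times γ A) := by
    refine ((hfreq γ₁ hγ₁.1 hγ₁.2).and_eventually ?_).exists.imp fun γ h => ⟨h.2, h.1⟩
    have hgap : 0 < sInf (Φ '' S) + ε - Φ γ₁ := by linarith
    have hen : ∀ᶠ γ in 𝓝 γ₁, K * energy (γ - γ₀) <
        K * energy (γ₁ - γ₀) + (sInf (Φ '' S) + ε - Φ γ₁) / 2 :=
      ((continuous_const.mul (continuous_energy.comp
        (continuous_id.sub continuous_const))).tendsto γ₁).eventually
        (gt_mem_nhds (lt_add_of_pos_right _ (half_pos hgap)))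
    filter_upwards [hSo.mem_nhds hγ₁, hen,
      eventually_volume_times_lt hF γ₁ (half_pos hgap)] with γ h1 h2 h3
    refine ⟨h1, ?_⟩
    simp only [hΦ] at h2 h3 ⊢
    linarith
  have hE : energy (γ - γ₀) ≤ τ ^ 2 * q / 32 := by
    have h1 : K * energy (γ - γ₀) ≤ 2 := by
      have : (0 : ℝ) ≤ volume.real (times γ F) := measureReal_nonneg
      simp only [hΦ] at hlt
      linarith
    have h2 : K * (τ ^ 2 * q / 32) = 2 := by rw [hK]; field_simp; norm_num
    exact le_of_mul_le_mul_left (h1.trans h2.ge) hK0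
  obtain ⟨s, L, v, hs, hd, hsum⟩ := exists_finset_isBendable hF hAF hA hσ0 hθ0 hγ.1 (half_pos hq)
    (ofReal_le_volume_of_energy_le hτ hq hγA hE)
  have hbS : bend γ s L v ∈ S :=
    ⟨norm_curve_bend_sub_lt s hτ hγ.1 hs hd, norm_deriv_bend_sub_lt s hτ hσ1 hγ.2 hs hd⟩
  have hbM : ‖deriv (bend γ s L v)‖ ≤ M := by
    have h1 := norm_le_norm_add_norm_sub' (deriv (bend γ s L v)) (deriv γ₀)
    have h2 := hbS.2
    rw [deriv_sub] at h2
    rw [hM]; linarith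
  have hcσ : c * σ ≤ 4 * M := by nlinarith
  have hV := volume_times_bend_le s hF hM0 hc hσ0 hcσ hθ hbM hs hd
  have hEn := energy_bend_sub_le s hs hd
  have hinf := csInf_le hbdd (mem_image_of_mem Φ hbS)
  have e1 : ∑ t ∈ s, c * σ * L t / (4 * M) = c * σ / (8 * M) * ∑ t ∈ s, 2 * L t := by
    rw [Finset.mul_sum]; refine Finset.sum_congr rfl fun t _ => ?_
    field_simp; ring
  have e2 : ∑ t ∈ s, 4 * L t * σ ^ 2 = 2 * σ ^ 2 * ∑ t ∈ s, 2 * L t := by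
    rw [Finset.mul_sum]; refine Finset.sum_congr rfl fun t _ => ?_
    ring
  rw [e1] at hV
  rw [e2] at hEn
  set ℓ := ∑ t ∈ s, 2 * L t
  have hℓ : 0 ≤ ℓ := le_trans (by positivity) hsum
  have e3 : K * (2 * σ ^ 2 * ℓ) ≤ c * σ / (16 * M) * ℓ := by
    have : K * (2 * σ ^ 2) ≤ c * σ / (16 * M) := by
      rw [le_div_iff₀ (by positivity)]
      nlinarith
    calc K * (2 * σ ^ 2 * ℓ) = K * (2 * σ ^ 2) * ℓ := by ring
      _ ≤ _ := by gcongr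
  have e4 : c * σ / (8 * M) * ℓ = c * σ / (16 * M) * ℓ + c * σ / (16 * M) * ℓ := by
    field_simp; ring
  have e5 : c * σ * q / (64 * M) ≤ c * σ / (16 * M) * ℓ := by
    have : c * σ * q / (64 * M) = c * σ / (16 * M) * (q / 2 / 2) := by field_simp; norm_num
    rw [this]; gcongr
  have e6 : K * energy (bend γ s L v - γ₀) ≤ K * energy (γ - γ₀) + K * (2 * σ ^ 2 * ℓ) := by
    rw [← mul_add]; gcongr
  simp only [hΦ] at hlt hinf
  linarith

end C1Curve

/-! ### A Borel hull of a porous set, and the Baire category argument -/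

section PorousHull

variable {X : Type*} [NormedAddCommGroup X]

/-- The union of the balls `B(h, r / c)`, `r ≤ 1 / (n + 1)`, for which `B(h, r)` misses `E`. -/
def holeNhd (c : ℝ) (E : Set X) (n : ℕ) : Set X :=
  ⋃ (h : X) (r : ℝ) (_ : r ≤ 1 / (n + 1 : ℝ) ∧ Disjoint (Metric.ball h r) E), Metric.ball h (r / c)

theorem isOpen_holeNhd (c : ℝ) (E : Set X) (n : ℕ) : IsOpen (holeNhd c E n) :=
  isOpen_iUnion fun _ => isOpen_iUnion fun _ => isOpen_iUnion fun _ => Metric.isOpen_ball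

theorem antitone_holeNhd (c : ℝ) (E : Set X) : Antitone (holeNhd c E) := by
  intro m n hmn x hx
  simp only [holeNhd, mem_iUnion] at hx ⊢
  obtain ⟨h, r, ⟨hr, hd⟩, hx⟩ := hx
  exact ⟨h, r, ⟨hr.trans (by gcongr), hd⟩, hx⟩

theorem IsPorousAt.mem_holeNhd {c : ℝ} (hc : 0 < c) (hc1 : c < 1) {E : Set X} {x : X}
    (h : IsPorousAt c E x) (n : ℕ) : x ∈ holeNhd c E n := by
  obtain ⟨y, r, hr, hxy, hball, hlt⟩ := h (1 / (n + 1 : ℝ)) (by positivity)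
  simp only [holeNhd, mem_iUnion]
  -- Shrinking the radius is harmless: `c * dist x y` is also below `1 / (n + 1)`, because `c < 1`
  -- and `y` was taken that close to `x`.
  refine ⟨y, min r (1 / (n + 1 : ℝ)), ⟨min_le_right _ _, ?_⟩, ?_⟩
  · exact (disjoint_iff_inter_eq_empty.2 hball).mono_left
      (Metric.ball_subset_ball (min_le_left _ _))
  · rw [Metric.mem_ball, lt_div_iff₀ hc, mul_comm]
    exact lt_min hlt ((mul_le_of_le_one_left dist_nonneg hc1.le).trans_lt hxy)

/-- An open ball missing `E` misses its closure, so it cannot be centred at `x`. The cap on `r`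
bounds the distance to its centre by `1 / ((n + 1) * c)`. -/
theorem hasHolesAt_closure {c : ℝ} (hc : 0 < c) {E : Set X} {x : X}
    (hx : x ∈ closure E ∩ ⋂ n, holeNhd c E n) : C1Curve.HasHolesAt c (closure E) x := by
  intro δ hδ
  obtain ⟨n, hn⟩ := exists_nat_one_div_lt (mul_pos hc hδ)
  have hxn := mem_iInter.1 hx.2 n
  simp only [holeNhd, mem_iUnion] at hxn
  obtain ⟨y, r, ⟨hr, hd⟩, hxy⟩ := hxn
  have hd' : Disjoint (Metric.ball y r) (closure E) := hd.closure_right Metric.isOpen_ball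
  rw [mem_ball_iff_norm, norm_sub_rev, lt_div_iff₀ hc] at hxy
  have hr0 : 0 < r := lt_of_le_of_lt (by positivity) hxy
  refine ⟨y, norm_pos_iff.2 (sub_ne_zero.2 ?_), ?_, ?_⟩
  · rintro rfl
    exact hd'.le_bot ⟨Metric.mem_ball_self hr0, hx.1⟩
  · nlinarith
  · exact hd'.mono_left (Metric.ball_subset_ball (by linarith))

theorem IsPorous.isGammaOneNull {H : Type*} [NormedAddCommGroup H] [InnerProductSpace ℝ H]
    [CompleteSpace H] {E : Set H} (hE : IsPorous E) :
    IsGammaOneNull E := by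
  obtain ⟨c, ⟨hc, hc1⟩, hE⟩ := hE
  set A : Set H := closure E ∩ ⋂ n, holeNhd c E n
  have hEA : E ⊆ A := fun x hx =>
    ⟨subset_closure hx, mem_iInter.2 fun n => (hE x hx).mem_holeNhd hc hc1 n⟩
  let : MeasurableSpace (C1Curve H) := borel _
  have : BorelSpace (C1Curve H) := ⟨rfl⟩
  have hmeas : Measurable fun γ : C1Curve H => volume (C1Curve.times γ A) :=
    C1Curve.measurable_volume_times isClosed_closure (isOpen_holeNhd c E) (antitone_holeNhd c E)
  have key : ∀ n : ℕ, ∀ᶠ γ : C1Curve H in residual (C1Curve H),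
      volume (C1Curve.times γ A) < ENNReal.ofReal (1 / (n + 1 : ℝ)) := by
    intro n
    set N : Set (C1Curve H) :=
      {γ | ENNReal.ofReal (1 / (n + 1 : ℝ)) ≤ volume (C1Curve.times γ A)}
    have hNm : MeasurableSet N := measurableSet_le measurable_const hmeas
    -- Baire property: the Borel set `N` agrees with an open set up to a meagre set. If `U` is
    -- nonempty, `N` is dense in it, since the curve space is Baire.
    obtain ⟨U, hU, hNU⟩ := hNm.residualEq_isOpen
    have hNU : ∀ᶠ γ in residual (C1Curve H), (γ ∈ N ↔ γ ∈ U) := hNU.mem_iff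
    rcases U.eq_empty_or_nonempty with rfl | ⟨γ₀, hγ₀⟩
    · filter_upwards [hNU] with γ hγ
      exact not_le.1 fun h => (hγ.1 h).elim
    · exfalso
      obtain ⟨ε, hε, hball⟩ := Metric.isOpen_iff.1 hU γ₀ hγ₀
      refine C1Curve.not_forall_frequently_volume_times (A := A) isClosed_closure inter_subset_left hc hc1
        (fun x hx => hasHolesAt_closure hc hx) γ₀ (half_pos hε)
        (show (0 : ℝ) < 1 / (n + 1 : ℝ) by positivity) fun γ h1 h2 => ?_
      have hγU : γ ∈ U := hball (by
        exact mem_ball_iff_norm.2 ((C1Curve.norm_eq (γ - γ₀)).trans_lt (by linarith)))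
      have hfr : ∃ᶠ δ in 𝓝 γ, (δ ∈ N ↔ δ ∈ U) :=
        mem_closure_iff_frequently.1 (dense_of_mem_residual hNU γ)
      exact (hfr.and_eventually (hU.mem_nhds hγU)).mono fun δ h => h.1.2 h.2
  filter_upwards [eventually_countable_forall.2 key] with γ hγ
  have h0 : volume (C1Curve.times γ A) = 0 := by
    by_contra hne
    have hpos : 0 < (volume (C1Curve.times γ A)).toReal :=
      ENNReal.toReal_pos hne (C1Curve.volume_times_ne_top γ A)
    obtain ⟨n, hn⟩ := exists_nat_one_div_lt hpos
    exact absurd (hγ n) (not_lt.2 (ENNReal.ofReal_le_of_le_toReal hn.le))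
  refine measure_mono_null ?_ h0
  rintro t ⟨ht, htE⟩
  exact ⟨ht, hEA (by rwa [C1Curve.ext_of_mem γ ht])⟩

end PorousHull

theorem theorem3 {H : Type*} [NormedAddCommGroup H] [InnerProductSpace ℝ H] [CompleteSpace H]
    (P : Set H) (hP : IsSigmaPorous P) : IsGammaOneNull P := by
  obtain ⟨E, hE, rfl⟩ := hP
  have h := eventually_countable_forall.2 fun n => (hE n).isGammaOneNull
  filter_upwards [h] with γ hγ
  refine measure_mono_null ?_ (measure_iUnion_null hγ)
  rintro t ⟨ht, htE⟩
  obtain ⟨n, hn⟩ := mem_iUnion.1 htE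
  exact mem_iUnion.2 ⟨n, ht, hn⟩
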